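/- Let $f:\mathbb R^n\to\mathbb R$ be of class $C^2$, $g:\mathbb R^p\to\mathbb R^m$ of class $C^2$ (it suffices: on an open set $U\subseteq\mathbb R^p$ containing the $y$-components of all points considered below), $A:\mathbb R^n\to\mathbb R^m$ linear, $b\in\mathbb R^m$ and $h:\mathbb R^n\to\mathbb R^q$ continuous. Put $c(x,y)=g(y)+Ax+b$, $X=\{x: h(x)\ge 0\}$ and consider the program $$\max_{x,y} f(x)\quad\text{subject to}\quad c(x,y)=0,\ h(x)\ge 0,$$ with augmented Lagrangian $\mathcal L_\rho(x,y;\lambda)=f(x)+\lambda' c(x,y)-\frac{\rho}{2}\|c(x,y)\|^2$. Let $\bar\lambda\in\mathbb R^m_{\ge 0}$, let $\rho^k>0$ be nondecreasing with $\rho^k\to\infty$, and let $s\in\{1,-1\}$. The centralized method of multipliers in a closed region $N\subseteq\mathbb R^n\times\mathbb R^p$ ($N=\mathbb R^n\times\mathbb R^p$ if the maximization is global, a smaller $N$ if it is carried out locally) starts with $\lambda^0=0$ and iterates $$(x^{k+1},y^{k+1})\in\operatorname*{arg\,max}_{(x,y)\in N,\ h(x)\ge 0}\mathcal L_{\rho^k}(x,y;\lambda^k),\qquad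 \lambda^{k+1}=\Pi_{[-\bar\lambda,\bar\lambda]}\{\lambda^k+s\,\rho^k\,c(x^{k+1},y^{k+1})\}.$$ A vector $\lambda^*$ is called a multiplier at a feasible point $(x^*,y^*)$ if $Dg(y^*)'\lambda^*=0$ and $(\nabla f(x^*)+A'\lambda^*)'(x-x^*)\le 0$ for all $x\in X$. 1. Let $N$ be closed and contain a feasible point, let $S_N$ be the set of maximizers of $f$ among the feasible points in $N$, and let $(x^k,y^k,\lambda^k)_k$ be generated by the method in $N$. Then $c(x^k,y^k)\to 0$, and every limit point of $(x^k,y^k)$ belongs to $S_N$ and is, if interior to $N$ (always, if $N$ is the whole space), a local optimum of the program. If moreover $\{(x,y)\in N: h(x)\ge0,\ \|c(x,y)\|\le\varepsilon\}$ is bounded for some $\varepsilon>0$, then $S_N\neq\emptyset$; the distance of $(x^k,y^k)$ to $S_N$ tends to $0$; $f(x^k)$ tends to the maximal value of $f$ over the feasible points in $N$; if $S_N$ is a single point, then $(x^k,y^k)$ converges to it; and if $S_N$ lies in the interior of $N$, then for all large $k$ the iterate $(x^{k+1},y^{k+1})$ is a local maximizer of $\mathcal L_{\rho^k}(\cdot;\lambda^k)$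 over $\{h(x)\ge 0\}$ (without the restriction to $N$), and, if in addition $s=-1$, $X$ is convex and some $\lambda^*\in[-\bar\lambda,\bar\lambda]$ is the unique multiplier at every point of $S_N$, then $\lambda^k\to\lambda^*$. 2. Let $(x^*,y^*)$ be a strict local optimum of the program. There is $r_0>0$, depending only on the program and on $(x^*,y^*)$, such that for all $0<r\le r_0$ and all $s,\bar\lambda,(\rho^k)$ as above the method in the closed ball $N$ of radius $r$ around $(x^*,y^*)$ (in the norm $\max(\|x\|,\|y\|)$) has at least one run, and every run satisfies: $(x^k,y^k)\to(x^*,y^*)$; for all large $k$ the iterate $(x^{k+1},y^{k+1})$ is a local maximizer of $\mathcal L_{\rho^k}(\cdot;\lambda^k)$ over $\{h(x)\ge 0\}$; and, if $s=-1$, $X$ is convex and $(x^*,y^*)$ has a unique multiplier $\lambda^*$, which lies in $[-\bar\lambda,\bar\lambda]$, then $\lambda^k\to\lambda^*$. -/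

import Mathlib

open Filter Topology Set

/-- Data of the program: maximize `f x` over `(x, y) ∈ ℝⁿ × ℝᵖ` subject to
`g y + A x + b = 0` (in `ℝᵐ`) and `h x ≥ 0` (componentwise, in `ℝ^q`). -/
structure CompactOPF (n p m q : ℕ) where
  f : EuclideanSpace ℝ (Fin n) → ℝ
  g : EuclideanSpace ℝ (Fin p) → EuclideanSpace ℝ (Fin m)
  A : EuclideanSpace ℝ (Fin n) →L[ℝ] EuclideanSpace ℝ (Fin m)
  b : EuclideanSpace ℝ (Fin m)
  h : EuclideanSpace ℝ (Fin n) → EuclideanSpace ℝ (Fin q)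

namespace CompactOPF

/-- The pairs `(x, y)`. -/
abbrev Pt (n p : ℕ) : Type := EuclideanSpace ℝ (Fin n) × EuclideanSpace ℝ (Fin p)

/-- The value `g y + A x + b` of the equality constraint. -/
def residual {n p m q : ℕ} (P : CompactOPF n p m q) (z : Pt n p) : EuclideanSpace ℝ (Fin m) :=
  P.g z.2 + P.A z.1 + P.b

/-- The set `{x | h x ≥ 0}`. -/
def xSet {n p m q : ℕ} (P : CompactOPF n p m q) : Set (EuclideanSpace ℝ (Fin n)) :=
  {x | ∀ i, 0 ≤ P.h x i}

/-- The feasible set of the program. -/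
def feasible {n p m q : ℕ} (P : CompactOPF n p m q) : Set (Pt n p) :=
  {z | P.residual z = 0 ∧ z.1 ∈ P.xSet}

/-- The points that maximize the objective among the feasible points in the region `N`.
For `N = univ` these are the global optima of the program. -/
def solutions {n p m q : ℕ} (P : CompactOPF n p m q) (N : Set (Pt n p)) : Set (Pt n p) :=
  {z | z ∈ P.feasible ∩ N ∧ ∀ w ∈ P.feasible ∩ N, P.f w.1 ≤ P.f z.1}

/-- `z` is a local optimum of the program. -/
def IsLocalOptimum {n p m q : ℕ} (P : CompactOPF n p m q) (z : Pt n p) : Prop :=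
  z ∈ P.feasible ∧ IsLocalMaxOn (fun w : Pt n p => P.f w.1) P.feasible z

/-- `z` is a strict local optimum of the program. -/
def IsStrictLocalOptimum {n p m q : ℕ} (P : CompactOPF n p m q) (z : Pt n p) : Prop :=
  z ∈ P.feasible ∧ ∀ᶠ w in 𝓝 z, w ∈ P.feasible → w ≠ z → P.f w.1 < P.f z.1

/-- The augmented Lagrangian. -/
noncomputable def augLagrangian {n p m q : ℕ} (P : CompactOPF n p m q) (rho : ℝ)
    (lam : EuclideanSpace ℝ (Fin m)) (z : Pt n p) : ℝ :=
  P.f z.1 + inner ℝ lam (P.residual z) - rho / 2 * ‖P.residual z‖ ^ 2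

/-- `lam` is a vector of Lagrange multipliers for the equality constraint at `z = (x, y)`:
the Lagrangian `f x + lam ⬝ (g y + A x + b)` is stationary in `y`, and its derivative in `x`
is nonpositive in every direction that points from `x` into `{h ≥ 0}`. -/
def IsMultiplier {n p m q : ℕ} (P : CompactOPF n p m q) (z : Pt n p)
    (lam : EuclideanSpace ℝ (Fin m)) : Prop :=
  (∀ v : EuclideanSpace ℝ (Fin p), inner ℝ lam (fderiv ℝ P.g z.2 v) = 0) ∧
  ∀ x ∈ P.xSet, fderiv ℝ P.f z.1 (x - z.1) + inner ℝ lam (P.A (x - z.1)) ≤ 0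

/-- `lam` is the only vector of Lagrange multipliers at `z`. -/
def IsTheMultiplier {n p m q : ℕ} (P : CompactOPF n p m q) (z : Pt n p)
    (lam : EuclideanSpace ℝ (Fin m)) : Prop :=
  P.IsMultiplier z lam ∧ ∀ lam', P.IsMultiplier z lam' → lam' = lam

/-- Membership in the box `[-lamBar₁, lamBar₁] × ⋯ × [-lamBarₘ, lamBarₘ]`. -/
def InBox {m : ℕ} (lamBar lam : EuclideanSpace ℝ (Fin m)) : Prop :=
  ∀ i, -lamBar i ≤ lam i ∧ lam i ≤ lamBar i

/-- Euclidean projection onto the box (for `lamBar ≥ 0`). -/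
noncomputable def boxProj {m : ℕ} (lamBar lam : EuclideanSpace ℝ (Fin m)) :
    EuclideanSpace ℝ (Fin m) :=
  WithLp.toLp 2 fun i => max (-lamBar i) (min (lamBar i) (lam i))

/-- The points `z = (x, y)` of the region `N` with `h x ≥ 0`. -/
def searchSet {n p m q : ℕ} (P : CompactOPF n p m q) (N : Set (Pt n p)) : Set (Pt n p) :=
  {z | z ∈ N ∧ z.1 ∈ P.xSet}

/-- `(z k, lam k)` is generated by the centralized method of multipliers with gains `rho k`:
`lam 0 = 0`; the iterate `z (k+1)` maximizes the augmented Lagrangian with gain `rho k` and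
multiplier `lam k` over the points of `N` with `h x ≥ 0`; and `lam (k+1)` is the projection onto
the box of `lam k + s * rho k * (g y + A x + b)` at `z (k+1)`. With `N = univ` the maximization
is over all `(x, y)` with `h x ≥ 0`; a smaller `N` means that it is carried out locally, in `N`.
The sign `s` is `1` or `-1`. The point `z 0` is arbitrary. -/
structure IsRun {n p m q : ℕ} (P : CompactOPF n p m q) (N : Set (Pt n p)) (s : ℝ)
    (lamBar : EuclideanSpace ℝ (Fin m)) (rho : ℕ → ℝ) (z : ℕ → Pt n p)
    (lam : ℕ → EuclideanSpace ℝ (Fin m)) : Prop where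
  lam_zero : lam 0 = 0
  mem : ∀ k, z (k + 1) ∈ P.searchSet N
  isMax : ∀ k, IsMaxOn (P.augLagrangian (rho k) (lam k)) (P.searchSet N) (z (k + 1))
  update : ∀ k, lam (k + 1) = boxProj lamBar (lam k + (s * rho k) • P.residual (z (k + 1)))

/-- Admissible parameters of the method: a nonnegative vector of multiplier bounds, positive gains
that increase to infinity, and a sign. -/
structure IsParam {m : ℕ} (s : ℝ) (lamBar : EuclideanSpace ℝ (Fin m)) (rho : ℕ → ℝ) : Prop where
  sign : s = 1 ∨ s = -1
  lamBar_nonneg : ∀ i, 0 ≤ lamBar i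
  rho_pos : ∀ k, 0 < rho k
  rho_mono : Monotone rho
  rho_tendsto : Tendsto rho atTop atTop

end CompactOPF

/-!
The method is a penalty method with bounded multiplier estimates, and everything follows from one
inequality.  A feasible `w ∈ N` has residual zero, so maximality of the iterate `z = z (k+1)` gives
`f w ≤ f z + ⟪lam, c z⟫ - rho / 2 * ‖c z‖ ^ 2`, with `‖lam‖ ≤ ‖lamBar‖` because of the projection.

* Residuals tend to zero (`IsRun.tendsto_residual`).  On an unbounded region `f` need not be bounded
  above, but the very first iterate, where `lam = 0`, maximizes `f - rho 0 / 2 * ‖c‖ ^ 2`, so that `f`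
  is at most a constant plus `rho 0 / 2 * ‖c‖ ^ 2`.  Inserting this bounds
  `(rho k - rho 0) / 2 * ‖c‖ ^ 2 - ‖lamBar‖ * ‖c‖` by a constant, while `rho k → ∞`.
* Dropping the penalty, `f w ≤ f z + ‖lamBar‖ * ‖c z‖`; in the limit, every cluster point is a
  solution in `N` (`IsRun.mem_solutions`).  If the almost feasible points form a bounded set, the
  iterates eventually stay in a compact set, hence eventually enter every open set that contains the
  solutions (`IsRun.eventually_mem`); the remaining claims about `z` are read off from this.
* Once the iterate is interior to `N`, the first-order conditions say that
  `lam k - rho k • c (z (k+1))` is a multiplier at `z (k+1)` (`isMultiplier_of_isLocalMaxOn`).  For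
  `s = -1` the next `lam` is the projection of this vector.  Multipliers at points that approach the
  solutions converge to the common unique multiplier (`tendsto_of_isMultiplier`), and the projection
  is continuous and fixes the box.

For the second part, a small closed ball around a strict local optimum is a region whose only
solution is its centre, and the maximizers that a run needs exist by compactness.
-/

namespace CompactOPF

variable {n p m q : ℕ}

/-! ### The box and the projection onto it -/

theorem inBox_boxProj {lamBar : EuclideanSpace ℝ (Fin m)} (h : ∀ i, 0 ≤ lamBar i)
    (lam : EuclideanSpace ℝ (Fin m)) : InBox lamBar (boxProj lamBar lam) := by
  intro i
  have := h i
  exact ⟨le_max_left _ _, max_le (by linarith) (min_le_left _ _)⟩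

theorem InBox.norm_le {lamBar lam : EuclideanSpace ℝ (Fin m)} (h : InBox lamBar lam) :
    ‖lam‖ ≤ ‖lamBar‖ := by
  rw [EuclideanSpace.norm_eq, EuclideanSpace.norm_eq]
  refine Real.sqrt_le_sqrt (Finset.sum_le_sum fun i _ => ?_)
  have h1 : |lam i| ≤ |lamBar i| :=
    (abs_le.2 (h i)).trans (le_abs_self _)
  simpa only [Real.norm_eq_abs] using pow_le_pow_left₀ (abs_nonneg _) h1 2

theorem InBox.boxProj_eq {lamBar lam : EuclideanSpace ℝ (Fin m)} (h : InBox lamBar lam) :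
    boxProj lamBar lam = lam := by
  ext i
  simp [boxProj, min_eq_right (h i).2, max_eq_right (h i).1]

theorem continuous_boxProj (lamBar : EuclideanSpace ℝ (Fin m)) : Continuous (boxProj lamBar) := by
  unfold boxProj
  fun_prop

/-! ### Continuity and derivatives of the program data -/

section Regularity

variable {P : CompactOPF n p m q}

theorem isClosed_xSet (hh : Continuous P.h) : IsClosed P.xSet := by
  simp only [xSet, ofPred_forall]
  exact isClosed_iInter fun i => isClosed_le continuous_const (by fun_prop)

theorem isClosed_searchSet (hh : Continuous P.h) {N : Set (Pt n p)} (hN : IsClosed N) :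
    IsClosed (P.searchSet N) :=
  hN.inter ((isClosed_xSet hh).preimage continuous_fst)

theorem continuousAt_residual {z : Pt n p} (hg : ContinuousAt P.g z.2) :
    ContinuousAt P.residual z := by
  have h1 : ContinuousAt (fun w : Pt n p => P.g w.2) z := hg.comp continuousAt_snd
  unfold residual
  fun_prop

theorem continuousAt_augLagrangian {z : Pt n p} (hf : Continuous P.f) (hg : ContinuousAt P.g z.2)
    (rho : ℝ) (lam : EuclideanSpace ℝ (Fin m)) : ContinuousAt (P.augLagrangian rho lam) z := by
  have := continuousAt_residual hg
  unfold augLagrangian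
  fun_prop

theorem isCompact_almostFeasible (hh : Continuous P.h) {N : Set (Pt n p)} (hN : IsClosed N)
    (hg : ∀ w ∈ N, ContinuousAt P.g w.2) {ε : ℝ}
    (hb : Bornology.IsBounded {w | w ∈ P.searchSet N ∧ ‖P.residual w‖ ≤ ε}) :
    IsCompact {w | w ∈ P.searchSet N ∧ ‖P.residual w‖ ≤ ε} := by
  refine Metric.isCompact_of_isClosed_isBounded ?_ hb
  have hc : ContinuousOn (fun w => ‖P.residual w‖) (P.searchSet N) := fun w hw =>
    (continuousAt_residual (hg w hw.1)).norm.continuousWithinAt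
  exact hc.preimage_isClosed_of_isClosed (isClosed_searchSet hh hN) isClosed_Iic

theorem hasFDerivAt_augLagrangian {z : Pt n p} (hf : DifferentiableAt ℝ P.f z.1)
    (hg : DifferentiableAt ℝ P.g z.2) (rho : ℝ) (lam : EuclideanSpace ℝ (Fin m)) :
    ∃ L : Pt n p →L[ℝ] ℝ, HasFDerivAt (P.augLagrangian rho lam) L z ∧
      ∀ v, L v = fderiv ℝ P.f z.1 v.1 +
        inner ℝ (lam - rho • P.residual z) (fderiv ℝ P.g z.2 v.2 + P.A v.1) := by
  have h1 : HasFDerivAt (fun w : Pt n p => P.f w.1) _ z := hf.hasFDerivAt.comp z hasFDerivAt_fst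
  have h2 : HasFDerivAt (fun w : Pt n p => P.g w.2) _ z := hg.hasFDerivAt.comp z hasFDerivAt_snd
  have h3 : HasFDerivAt (fun w : Pt n p => P.A w.1) _ z :=
    P.A.hasFDerivAt.comp z hasFDerivAt_fst
  have h4 : HasFDerivAt P.residual _ z := (h2.add h3).add_const P.b
  refine ⟨_, (h1.add ((hasFDerivAt_const lam z).inner ℝ h4)).sub
    (h4.norm_sq.const_mul (rho / 2)), fun v => ?_⟩
  simp [inner_sub_left, inner_smul_left, inner_add_right]
  ring

/-- First-order conditions: at a constrained local maximizer of the augmented Lagrangian, the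
first-order multiplier update is a multiplier in the sense of `IsMultiplier`, which does not require
feasibility of the point. -/
theorem isMultiplier_of_isLocalMaxOn (hX : Convex ℝ P.xSet) {z : Pt n p} (hz : z.1 ∈ P.xSet)
    (hf : DifferentiableAt ℝ P.f z.1) (hg : DifferentiableAt ℝ P.g z.2) {rho : ℝ}
    {lam : EuclideanSpace ℝ (Fin m)}
    (hmax : IsLocalMaxOn (P.augLagrangian rho lam) (P.searchSet univ) z) :
    P.IsMultiplier z (lam - rho • P.residual z) := by
  obtain ⟨L, hL, hLv⟩ := hasFDerivAt_augLagrangian hf hg rho lam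
  have hconv : Convex ℝ (P.searchSet univ) :=
    convex_univ.inter (hX.linear_preimage (LinearMap.fst ℝ _ (EuclideanSpace ℝ (Fin p))))
  have key : ∀ w ∈ P.searchSet univ, L (w - z) ≤ 0 := fun w hw =>
    hmax.hasFDerivWithinAt_nonpos hL.hasFDerivWithinAt
      (sub_mem_posTangentConeAt_of_segment_subset (hconv.segment_subset ⟨mem_univ _, hz⟩ hw))
  constructor
  · intro v
    have h1 := key (z.1, z.2 + v) ⟨mem_univ _, hz⟩
    have h2 := key (z.1, z.2 - v) ⟨mem_univ _, hz⟩
    simp only [hLv, Prod.fst_sub, Prod.snd_sub, sub_self, add_sub_cancel_left, sub_sub_cancel_left,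
      map_zero, map_neg, add_zero, zero_add, inner_neg_right] at h1 h2
    linarith
  · intro x hx
    have h1 := key (x, z.2) ⟨mem_univ _, hx⟩
    simpa only [hLv, Prod.fst_sub, Prod.snd_sub, sub_self, map_zero, zero_add] using h1

end Regularity

/-! ### Cluster points -/

theorem le_of_mapClusterPt {α ι : Type*} [TopologicalSpace α] {l : Filter ι} {u : ι → α} {a : α}
    (ha : MapClusterPt a l u) {φ ψ : α → ℝ} (hφ : ContinuousAt φ a) (hψ : ContinuousAt ψ a)
    (hle : ∀ᶠ i in l, φ (u i) ≤ ψ (u i)) : φ a ≤ ψ a := by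
  have : (𝓝 a ⊓ map u l).NeBot := ha
  exact le_of_tendsto_of_tendsto (hφ.mono_left inf_le_left) (hψ.mono_left inf_le_left)
    (Filter.Eventually.filter_mono (f₂ := map u l) inf_le_right hle)

/-- Stability of a unique multiplier: multipliers `mu i` at points `u i` whose cluster points all have
the same unique multiplier converge to it.  No bound on `mu` is assumed. -/
theorem tendsto_of_isMultiplier {P : CompactOPF n p m q} {ι : Type*} {l : Filter ι}
    {u : ι → Pt n p} {mu : ι → EuclideanSpace ℝ (Fin m)} {lamS : EuclideanSpace ℝ (Fin m)}
    {K : Set (Pt n p)} (hK : IsCompact K) (huK : ∀ᶠ i in l, u i ∈ K)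
    (hmu : ∀ᶠ i in l, P.IsMultiplier (u i) (mu i))
    (hreg : ∀ a, MapClusterPt a l u → P.IsTheMultiplier a lamS ∧
      ContinuousAt (fderiv ℝ P.f) a.1 ∧ ContinuousAt (fderiv ℝ P.g) a.2) :
    Tendsto mu l (𝓝 lamS) := by
  -- Shorten `mu i - lamS` to length at most one: the shortened vectors stay in a compact set, and
  -- they still satisfy the multiplier conditions in the limit because `lamS` does.
  set t : ι → ℝ := fun i => (max 1 ‖mu i - lamS‖)⁻¹ with ht
  have hmax : ∀ i, 0 < max 1 ‖mu i - lamS‖ := fun i => lt_max_of_lt_left one_pos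
  have ht0 : ∀ i, 0 < t i := fun i => inv_pos.2 (hmax i)
  have ht1 : ∀ i, t i ≤ 1 := fun i => inv_le_one_of_one_le₀ (le_max_left _ _)
  set nu : ι → EuclideanSpace ℝ (Fin m) := fun i => lamS + t i • (mu i - lamS) with hnu
  have hdist : ∀ i, dist (nu i) lamS = t i * ‖mu i - lamS‖ := fun i => by
    rw [dist_eq_norm, hnu, add_sub_cancel_left, norm_smul, Real.norm_of_nonneg (ht0 i).le]
  have hinner : ∀ i v, inner ℝ (nu i) v = (1 - t i) * inner ℝ lamS v + t i * inner ℝ (mu i) v :=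
    fun i v => by
      simp only [hnu, inner_add_left, inner_smul_left, inner_sub_left, conj_trivial]
      ring
  have hball : ∀ i, nu i ∈ Metric.closedBall lamS 1 := fun i => by
    rw [Metric.mem_closedBall, hdist]
    calc t i * ‖mu i - lamS‖ ≤ t i * max 1 ‖mu i - lamS‖ :=
          mul_le_mul_of_nonneg_left (le_max_right _ _) (ht0 i).le
      _ = 1 := inv_mul_cancel₀ (hmax i).ne'
  have hcl : ∀ a : Pt n p × EuclideanSpace ℝ (Fin m),
      MapClusterPt a l (fun i => (u i, nu i)) → a.2 = lamS := by
    rintro ⟨a, ν⟩ ha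
    obtain ⟨hthe, hcf, hcg⟩ := hreg a (ha.continuousAt_comp (f := Prod.fst) continuousAt_fst)
    have hcf' : ContinuousAt (fun b : Pt n p × EuclideanSpace ℝ (Fin m) => fderiv ℝ P.f b.1.1)
        (a, ν) := ContinuousAt.comp (f := fun b : Pt n p × EuclideanSpace ℝ (Fin m) => b.1.1)
          hcf (by fun_prop)
    have hcg' : ContinuousAt (fun b : Pt n p × EuclideanSpace ℝ (Fin m) => fderiv ℝ P.g b.1.2)
        (a, ν) := ContinuousAt.comp (f := fun b : Pt n p × EuclideanSpace ℝ (Fin m) => b.1.2)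
          hcg (by fun_prop)
    refine hthe.2 ν ⟨fun v => ?_, fun x hx => ?_⟩
    · have h1 := le_of_mapClusterPt ha
        (φ := fun b => |inner ℝ b.2 (fderiv ℝ P.g b.1.2 v)|)
        (ψ := fun b => |inner ℝ lamS (fderiv ℝ P.g b.1.2 v)|) (by fun_prop) (by fun_prop)
        (by
          filter_upwards [hmu] with i hi
          simp only [hinner, hi.1 v, mul_zero, add_zero, abs_mul]
          refine mul_le_of_le_one_left (abs_nonneg _) (abs_le.2 ⟨?_, ?_⟩) <;>
            linarith [ht0 i, ht1 i])
      simp only [hthe.1.1 v, abs_zero] at h1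
      exact abs_nonpos_iff.1 h1
    · have h1 := le_of_mapClusterPt ha
        (φ := fun b => fderiv ℝ P.f b.1.1 (x - b.1.1) + inner ℝ b.2 (P.A (x - b.1.1)))
        (ψ := fun b => max 0 (fderiv ℝ P.f b.1.1 (x - b.1.1) + inner ℝ lamS (P.A (x - b.1.1))))
        (by fun_prop) (by fun_prop)
        (by
          filter_upwards [hmu] with i hi
          simp only [hinner]
          have h2 := hi.2 x hx
          set d := fderiv ℝ P.f (u i).1 (x - (u i).1)
          set e := inner ℝ lamS (P.A (x - (u i).1))
          have h3 : (1 - t i) * (d + e) ≤ max 0 (d + e) := by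
            have h4 : (1 - t i) * (d + e) ≤ (1 - t i) * max 0 (d + e) :=
              mul_le_mul_of_nonneg_left (le_max_right _ _) (by linarith [ht1 i])
            exact h4.trans (mul_le_of_le_one_left (le_max_left _ _) (by linarith [ht0 i]))
          have h5 := mul_nonpos_of_nonneg_of_nonpos (ht0 i).le h2
          linarith)
      simpa only [max_eq_left (hthe.1.2 x hx)] using h1
  rw [Metric.tendsto_nhds]
  intro ε hε
  have hopen : IsOpen {a : Pt n p × EuclideanSpace ℝ (Fin m) | dist a.2 lamS < min ε 1} :=
    isOpen_lt (by fun_prop) continuous_const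
  have hev : ∀ᶠ i in l, dist (nu i) lamS < min ε 1 := by
    refine (hK.prod (isCompact_closedBall lamS 1)).adherence_nhdset
      (f := map (fun i => (u i, nu i)) l) ?_ hopen fun a _ ha => ?_
    · rw [le_principal_iff, mem_map]
      filter_upwards [huK] with i hi using ⟨hi, hball i⟩
    · rw [mem_ofPred_eq, hcl a ha, dist_self]
      exact lt_min hε one_pos
  filter_upwards [hev] with i hi
  -- A shortened vector of length less than one has not been shortened.
  rw [hdist, lt_min_iff] at hi
  have hle : ‖mu i - lamS‖ ≤ 1 := by
    by_contra! hlt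
    have h1 : t i * ‖mu i - lamS‖ = 1 := by
      rw [ht]
      simp only
      rw [max_eq_right hlt.le]
      exact inv_mul_cancel₀ (by linarith)
    linarith [hi.2]
  have h1 : t i = 1 := by simp [ht, max_eq_left hle]
  rw [h1, one_mul] at hi
  rw [dist_eq_norm]
  exact hi.1

/-! ### Convergence of the iterates -/

section Run

variable {P : CompactOPF n p m q} {N : Set (Pt n p)} {s : ℝ}
  {lamBar : EuclideanSpace ℝ (Fin m)} {rho : ℕ → ℝ} {z : ℕ → Pt n p}
  {lam : ℕ → EuclideanSpace ℝ (Fin m)}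

theorem IsRun.norm_lam_le (hrun : P.IsRun N s lamBar rho z lam) (hpar : IsParam s lamBar rho)
    (k : ℕ) : ‖lam k‖ ≤ ‖lamBar‖ := by
  cases k with
  | zero => rw [hrun.lam_zero, norm_zero]; exact norm_nonneg _
  | succ k => rw [hrun.update]; exact (inBox_boxProj hpar.lamBar_nonneg _).norm_le

/-- The basic inequality: the augmented Lagrangian of an iterate is at least the objective of every
feasible point of the region. -/
theorem IsRun.objective_add_penalty_le (hrun : P.IsRun N s lamBar rho z lam)
    (hpar : IsParam s lamBar rho) {w : Pt n p} (hw : w ∈ P.feasible ∩ N) (k : ℕ) :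
    P.f w.1 + rho k / 2 * ‖P.residual (z (k + 1))‖ ^ 2 ≤
      P.f (z (k + 1)).1 + ‖lamBar‖ * ‖P.residual (z (k + 1))‖ := by
  have h1 : P.augLagrangian (rho k) (lam k) w ≤ P.augLagrangian (rho k) (lam k) (z (k + 1)) :=
    hrun.isMax k ⟨hw.2, hw.1.2⟩
  have h2 := (real_inner_le_norm (lam k) (P.residual (z (k + 1)))).trans
    (mul_le_mul_of_nonneg_right (hrun.norm_lam_le hpar k) (norm_nonneg _))
  have h3 : P.residual w = 0 := hw.1.1
  simp only [augLagrangian, h3, inner_zero_right, norm_zero] at h1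
  linarith

theorem IsRun.objective_le (hrun : P.IsRun N s lamBar rho z lam)
    (hpar : IsParam s lamBar rho) {w : Pt n p} (hw : w ∈ P.feasible ∩ N) (k : ℕ) :
    P.f w.1 ≤ P.f (z (k + 1)).1 + ‖lamBar‖ * ‖P.residual (z (k + 1))‖ := by
  have h1 := hrun.objective_add_penalty_le hpar hw k
  have h2 : 0 ≤ rho k / 2 * ‖P.residual (z (k + 1))‖ ^ 2 :=
    mul_nonneg (half_pos (hpar.rho_pos k)).le (sq_nonneg _)
  linarith

theorem IsRun.tendsto_residual (hrun : P.IsRun N s lamBar rho z lam)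
    (hpar : IsParam s lamBar rho) (hne : (P.feasible ∩ N).Nonempty) :
    Tendsto (fun k => P.residual (z k)) atTop (𝓝 0) := by
  obtain ⟨w, hw⟩ := hne
  rw [← tendsto_add_atTop_iff_nat 1, Metric.tendsto_nhds]
  intro ε hε
  set M := P.f (z 1).1 - rho 0 / 2 * ‖P.residual (z 1)‖ ^ 2 with hM
  have hfM : ∀ v ∈ P.searchSet N, P.f v.1 ≤ M + rho 0 / 2 * ‖P.residual v‖ ^ 2 := fun v hv => by
    have h1 : P.augLagrangian (rho 0) (lam 0) v ≤ P.augLagrangian (rho 0) (lam 0) (z 1) :=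
      hrun.isMax 0 hv
    simp only [augLagrangian, hrun.lam_zero, inner_zero_left] at h1
    linarith
  have hMw : 0 ≤ M - P.f w.1 := by
    have h1 := hfM w ⟨hw.2, hw.1.2⟩
    have h3 : P.residual w = 0 := hw.1.1
    simp only [h3, norm_zero] at h1
    linarith
  set C := ‖lamBar‖ / ε + (M - P.f w.1) / ε ^ 2 with hC
  filter_upwards [hpar.rho_tendsto.eventually_gt_atTop (rho 0 + 2 * C)] with k hk
  rw [dist_zero_right]
  by_contra! hle
  set r := ‖P.residual (z (k + 1))‖ with hr
  have h1 := hrun.objective_add_penalty_le hpar hw k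
  have h2 := hfM _ (hrun.mem k)
  -- For `r ≥ ε`, both `‖lamBar‖ * r` and `M - f w` are bounded by multiples of `r ^ 2`.
  have hr0 : 0 < r := hε.trans_le hle
  have h3 : ‖lamBar‖ * r ≤ ‖lamBar‖ / ε * r ^ 2 := by
    rw [div_mul_eq_mul_div, le_div_iff₀ hε, sq, mul_assoc]
    gcongr
  have h4 : M - P.f w.1 ≤ (M - P.f w.1) / ε ^ 2 * r ^ 2 := by
    rw [div_mul_eq_mul_div, le_div_iff₀ (pow_pos hε 2)]
    gcongr
  have h5 : (rho 0 + 2 * C) * r ^ 2 < rho k * r ^ 2 :=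
    mul_lt_mul_of_pos_right hk (pow_pos hr0 2)
  have h6 : C * r ^ 2 = ‖lamBar‖ / ε * r ^ 2 + (M - P.f w.1) / ε ^ 2 * r ^ 2 := by
    rw [hC, add_mul]
  linarith

theorem IsRun.mem_solutions (hrun : P.IsRun N s lamBar rho z lam) (hpar : IsParam s lamBar rho)
    (hne : (P.feasible ∩ N).Nonempty) (hf : Continuous P.f) (hh : Continuous P.h)
    (hN : IsClosed N) (hg : ∀ w ∈ N, ContinuousAt P.g w.2) {a : Pt n p}
    (ha : MapClusterPt a atTop z) : a ∈ P.solutions N := by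
  have hres := hrun.tendsto_residual hpar hne
  have hmem : a ∈ P.searchSet N :=
    (isClosed_searchSet hh hN).mem_of_mapClusterPt ha <| by
      filter_upwards [eventually_ge_atTop 1] with k hk
      obtain ⟨j, rfl⟩ := Nat.exists_eq_add_of_le' hk
      exact hrun.mem j
  have hca := continuousAt_residual (hg a hmem.1)
  have h0 : P.residual a = 0 := by
    have h1 : MapClusterPt (P.residual a) atTop (fun k => P.residual (z k)) :=
      ha.continuousAt_comp hca
    exact eq_of_nhds_neBot (NeBot.mono h1 (inf_le_inf_left _ hres))
  refine ⟨⟨⟨h0, hmem.2⟩, hmem.1⟩, fun w hw => ?_⟩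
  have h1 := le_of_mapClusterPt ha (φ := fun _ => P.f w.1)
    (ψ := fun v => P.f v.1 + ‖lamBar‖ * ‖P.residual v‖) continuousAt_const
    (by fun_prop) (by
      filter_upwards [eventually_ge_atTop 1] with k hk
      obtain ⟨j, rfl⟩ := Nat.exists_eq_add_of_le' hk
      exact hrun.objective_le hpar hw j)
  simpa only [h0, norm_zero, mul_zero, add_zero] using h1

theorem isLocalOptimum_of_mem_solutions {a : Pt n p} (ha : a ∈ P.solutions N)
    (hint : a ∈ interior N) : P.IsLocalOptimum a := by
  refine ⟨ha.1.1, ?_⟩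
  filter_upwards [inter_mem_nhdsWithin P.feasible (mem_interior_iff_mem_nhds.1 hint)] with w hw
    using ha.2 w hw

theorem IsRun.isLocalMaxOn (hrun : P.IsRun N s lamBar rho z lam) {k : ℕ}
    (hint : z (k + 1) ∈ interior N) :
    IsLocalMaxOn (P.augLagrangian (rho k) (lam k)) (P.searchSet univ) (z (k + 1)) := by
  filter_upwards [inter_mem_nhdsWithin (P.searchSet univ) (mem_interior_iff_mem_nhds.1 hint)]
    with w hw using hrun.isMax k ⟨hw.2, hw.1.2⟩

theorem IsRun.eventually_mem_almostFeasible (hrun : P.IsRun N s lamBar rho z lam)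
    (hpar : IsParam s lamBar rho) (hne : (P.feasible ∩ N).Nonempty) {ε : ℝ} (hε : 0 < ε) :
    ∀ᶠ k in atTop, z k ∈ {w | w ∈ P.searchSet N ∧ ‖P.residual w‖ ≤ ε} := by
  filter_upwards [eventually_ge_atTop 1,
    (hrun.tendsto_residual hpar hne).eventually (Metric.closedBall_mem_nhds 0 hε)] with k hk hr
  obtain ⟨j, rfl⟩ := Nat.exists_eq_add_of_le' hk
  exact ⟨hrun.mem j, mem_closedBall_zero_iff.1 hr⟩

/-- If the almost feasible points of the region form a bounded set, the iterates eventually enter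
every open set that contains the solutions. -/
theorem IsRun.eventually_mem (hrun : P.IsRun N s lamBar rho z lam) (hpar : IsParam s lamBar rho)
    (hne : (P.feasible ∩ N).Nonempty) (hf : Continuous P.f) (hh : Continuous P.h)
    (hN : IsClosed N) (hg : ∀ w ∈ N, ContinuousAt P.g w.2) {ε : ℝ} (hε : 0 < ε)
    (hb : Bornology.IsBounded {w | w ∈ P.searchSet N ∧ ‖P.residual w‖ ≤ ε})
    {V : Set (Pt n p)} (hV : IsOpen V) (hsub : P.solutions N ⊆ V) : ∀ᶠ k in atTop, z k ∈ V :=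
  (isCompact_almostFeasible hh hN hg hb).adherence_nhdset (f := map z atTop)
    (le_principal_iff.2 (hrun.eventually_mem_almostFeasible hpar hne hε)) hV
    fun _ _ ha => hsub (hrun.mem_solutions hpar hne hf hh hN hg ha)

theorem IsRun.tendsto_lam (hrun : P.IsRun N s lamBar rho z lam) (hpar : IsParam s lamBar rho)
    (hne : (P.feasible ∩ N).Nonempty) (hf : ContDiff ℝ 2 P.f) (hh : Continuous P.h)
    (hN : IsClosed N) (hg : ∀ w ∈ N, ContDiffAt ℝ 2 P.g w.2) {ε : ℝ} (hε : 0 < ε)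
    (hb : Bornology.IsBounded {w | w ∈ P.searchSet N ∧ ‖P.residual w‖ ≤ ε})
    (hint : ∀ᶠ k in atTop, z (k + 1) ∈ interior N) (hs : s = -1) (hX : Convex ℝ P.xSet)
    {lamS : EuclideanSpace ℝ (Fin m)} (hbox : InBox lamBar lamS)
    (hthe : ∀ zs ∈ P.solutions N, P.IsTheMultiplier zs lamS) : Tendsto lam atTop (𝓝 lamS) := by
  have hgc : ∀ w ∈ N, ContinuousAt P.g w.2 := fun w hw => (hg w hw).continuousAt
  have hmu : Tendsto (fun k => lam k - rho k • P.residual (z (k + 1))) atTop (𝓝 lamS) := by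
    refine tendsto_of_isMultiplier (P := P) (u := fun k => z (k + 1))
      (isCompact_almostFeasible hh hN hgc hb)
      ((tendsto_add_atTop_nat 1).eventually (hrun.eventually_mem_almostFeasible hpar hne hε))
      ?_ fun a ha => ?_
    · filter_upwards [hint] with k hk
      exact isMultiplier_of_isLocalMaxOn hX (hrun.mem k).2
        (hf.differentiable (by norm_num)).differentiableAt
        ((hg _ (hrun.mem k).1).differentiableAt (by norm_num)) (hrun.isLocalMaxOn hk)
    · have ha' := hrun.mem_solutions hpar hne hf.continuous hh hN hgc
        (MapClusterPt.of_comp (tendsto_add_atTop_nat 1) ha)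
      exact ⟨hthe a ha', (hf.contDiffAt.fderiv_right (m := 1) (by norm_num)).continuousAt,
        ((hg a ha'.1.2).fderiv_right (m := 1) (by norm_num)).continuousAt⟩
  rw [← tendsto_add_atTop_iff_nat 1, ← hbox.boxProj_eq]
  refine ((continuous_boxProj lamBar).continuousAt.tendsto.comp hmu).congr fun k => ?_
  simp only [Function.comp, hrun.update, hs, neg_one_mul, neg_smul, sub_eq_add_neg]

/-- All claims about a run in a closed region with boundedly many almost feasible points. -/
theorem IsRun.convergence (hrun : P.IsRun N s lamBar rho z lam) (hpar : IsParam s lamBar rho)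
    (hne : (P.feasible ∩ N).Nonempty) (hf : ContDiff ℝ 2 P.f) (hh : Continuous P.h)
    (hN : IsClosed N) (hg : ∀ w ∈ N, ContDiffAt ℝ 2 P.g w.2) {ε : ℝ} (hε : 0 < ε)
    (hb : Bornology.IsBounded {w | w ∈ P.searchSet N ∧ ‖P.residual w‖ ≤ ε}) :
    (P.solutions N).Nonempty ∧
    Tendsto (fun k => Metric.infDist (z k) (P.solutions N)) atTop (𝓝 0) ∧
    (∀ zs ∈ P.solutions N, Tendsto (fun k => P.f (z k).1) atTop (𝓝 (P.f zs.1))) ∧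
    (∀ zs, P.solutions N = {zs} → Tendsto z atTop (𝓝 zs)) ∧
    (P.solutions N ⊆ interior N →
      (∀ᶠ k in atTop, IsLocalMaxOn (P.augLagrangian (rho k) (lam k))
        (P.searchSet univ) (z (k + 1))) ∧
      ∀ lamS : EuclideanSpace ℝ (Fin m), InBox lamBar lamS → s = -1 →
        Convex ℝ P.xSet → (∀ zs ∈ P.solutions N, P.IsTheMultiplier zs lamS) →
        Tendsto lam atTop (𝓝 lamS)) := by
  have hfc := hf.continuous
  have hgc : ∀ w ∈ N, ContinuousAt P.g w.2 := fun w hw => (hg w hw).continuousAt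
  have hev : ∀ {V : Set (Pt n p)}, IsOpen V → P.solutions N ⊆ V → ∀ᶠ k in atTop, z k ∈ V :=
    fun hV hsub => hrun.eventually_mem hpar hne hfc hh hN hgc hε hb hV hsub
  refine ⟨?_, ?_, fun zs hzs => ?_, fun zs hzs => ?_, fun hsub => ?_⟩
  · by_contra hemp
    rw [not_nonempty_iff_eq_empty] at hemp
    obtain ⟨k, hk⟩ := (hev isOpen_empty hemp.subset).exists
    exact hk
  · rw [Metric.tendsto_nhds]
    intro δ hδ
    refine hev (V := {v | dist (Metric.infDist v (P.solutions N)) 0 < δ})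
      (isOpen_lt ((Metric.continuous_infDist_pt _).dist continuous_const) continuous_const)
      fun v hv => ?_
    rw [mem_ofPred_eq, Metric.infDist_zero_of_mem hv, dist_self]
    exact hδ
  · refine tendsto_order.2 ⟨fun c hc => ?_, fun c hc => ?_⟩
    · have h1 : Tendsto (fun k => ‖lamBar‖ * ‖P.residual (z k)‖) atTop (𝓝 0) := by
        simpa using (hrun.tendsto_residual hpar hne).norm.const_mul ‖lamBar‖
      filter_upwards [eventually_ge_atTop 1, h1.eventually_lt_const (sub_pos.2 hc)] with k hk h2
      obtain ⟨j, rfl⟩ := Nat.exists_eq_add_of_le' hk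
      linarith [hrun.objective_le hpar hzs.1 j]
    · exact hev (V := {v | P.f v.1 < c}) (isOpen_lt (by fun_prop) continuous_const)
        fun v hv => (hzs.2 v hv.1).trans_lt hc
  · rw [tendsto_nhds]
    exact fun V hV hmem => hev hV (by rw [hzs]; exact singleton_subset_iff.2 hmem)
  · have hint : ∀ᶠ k in atTop, z (k + 1) ∈ interior N :=
      (tendsto_add_atTop_nat 1).eventually (hev isOpen_interior hsub)
    exact ⟨hint.mono fun k hk => hrun.isLocalMaxOn hk, fun lamS hbox hs hX hthe =>
      hrun.tendsto_lam hpar hne hf hh hN hg hε hb hint hs hX hbox hthe⟩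

end Run

/-! ### Existence of runs and strict local optima -/

theorem exists_isRun {P : CompactOPF n p m q} (hf : Continuous P.f) (hh : Continuous P.h)
    {N : Set (Pt n p)} (hN : IsCompact N) (hg : ∀ w ∈ N, ContinuousAt P.g w.2)
    (hne : (P.searchSet N).Nonempty) (s : ℝ) (lamBar : EuclideanSpace ℝ (Fin m)) (rho : ℕ → ℝ) :
    ∃ z lam, P.IsRun N s lamBar rho z lam := by
  have hcomp : IsCompact (P.searchSet N) :=
    hN.of_isClosed_subset (isClosed_searchSet hh hN.isClosed) fun _ hw => hw.1
  have hex : ∀ r lam, ∃ w ∈ P.searchSet N, IsMaxOn (P.augLagrangian r lam) (P.searchSet N) w :=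
    fun r lam => hcomp.exists_isMaxOn hne fun w hw =>
      (continuousAt_augLagrangian hf (hg w hw.1) r lam).continuousWithinAt
  choose Z hZ hZmax using hex
  obtain ⟨lam, hlam0, hlam⟩ : ∃ lam : ℕ → EuclideanSpace ℝ (Fin m), lam 0 = 0 ∧ ∀ k,
      lam (k + 1) = boxProj lamBar (lam k + (s * rho k) • P.residual (Z (rho k) (lam k))) :=
    ⟨fun k => Nat.rec (motive := fun _ => EuclideanSpace ℝ (Fin m)) 0
      (fun j l => boxProj lamBar (l + (s * rho j) • P.residual (Z (rho j) l))) k,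
      rfl, fun _ => rfl⟩
  -- `k - 1` is the index shift of the iterates; its truncation at `k = 0` only picks `z 0`, which is
  -- arbitrary.
  exact ⟨fun k => Z (rho (k - 1)) (lam (k - 1)), lam,
    { lam_zero := hlam0
      mem := fun k => hZ (rho k) (lam k)
      isMax := fun k => hZmax (rho k) (lam k)
      update := hlam }⟩

theorem solutions_eq_singleton {P : CompactOPF n p m q} {N : Set (Pt n p)} {zs : Pt n p}
    (hzs : zs ∈ P.feasible ∩ N)
    (hlt : ∀ w ∈ N, w ∈ P.feasible → w ≠ zs → P.f w.1 < P.f zs.1) : P.solutions N = {zs} := by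
  refine Subset.antisymm (fun w hw => ?_) (singleton_subset_iff.2 ⟨hzs, fun w hw => ?_⟩)
  · by_contra hne
    exact (hlt w hw.1.2 hw.1.1 hne).not_ge (hw.2 zs hzs)
  · rcases eq_or_ne w zs with rfl | hne
    · exact le_rfl
    · exact (hlt w hw.2 hw.1 hne).le

end CompactOPF

theorem theorem1 {n p m q : ℕ} (P : CompactOPF n p m q)
    (hf : ContDiff ℝ 2 P.f) (hh : Continuous P.h)
    (U : Set (EuclideanSpace ℝ (Fin p))) (hU : IsOpen U) (hg : ContDiffOn ℝ 2 P.g U) :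
    -- Part 1: arbitrary closed search regions, in particular the whole space
    (∀ N : Set (CompactOPF.Pt n p), IsClosed N → (∀ w ∈ N, w.2 ∈ U) →
      (P.feasible ∩ N).Nonempty →
      ∀ (s : ℝ) (lamBar : EuclideanSpace ℝ (Fin m)) (rho : ℕ → ℝ),
      CompactOPF.IsParam s lamBar rho →
      ∀ (z : ℕ → CompactOPF.Pt n p) (lam : ℕ → EuclideanSpace ℝ (Fin m)),
      P.IsRun N s lamBar rho z lam →
      Tendsto (fun k => P.residual (z k)) atTop (𝓝 0) ∧
      (∀ zc, MapClusterPt zc atTop z →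
        zc ∈ P.solutions N ∧ (zc ∈ interior N → P.IsLocalOptimum zc)) ∧
      ((∃ ε > 0, Bornology.IsBounded {w | w ∈ P.searchSet N ∧ ‖P.residual w‖ ≤ ε}) →
        (P.solutions N).Nonempty ∧
        Tendsto (fun k => Metric.infDist (z k) (P.solutions N)) atTop (𝓝 0) ∧
        (∀ zs ∈ P.solutions N, Tendsto (fun k => P.f (z k).1) atTop (𝓝 (P.f zs.1))) ∧
        (∀ zs, P.solutions N = {zs} → Tendsto z atTop (𝓝 zs)) ∧
        (P.solutions N ⊆ interior N →
          (∀ᶠ k in atTop, IsLocalMaxOn (P.augLagrangian (rho k) (lam k))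
            (P.searchSet univ) (z (k + 1))) ∧
          ∀ lamS : EuclideanSpace ℝ (Fin m), CompactOPF.InBox lamBar lamS → s = -1 →
            Convex ℝ P.xSet → (∀ zs ∈ P.solutions N, P.IsTheMultiplier zs lamS) →
            Tendsto lam atTop (𝓝 lamS)))) ∧
    -- Part 2: local convergence of the whole sequence to a strict local optimum
    (∀ zs : CompactOPF.Pt n p, P.IsStrictLocalOptimum zs → zs.2 ∈ U →
      ∃ r₀ > 0, ∀ r, 0 < r → r ≤ r₀ →
        ∀ (s : ℝ) (lamBar : EuclideanSpace ℝ (Fin m)) (rho : ℕ → ℝ),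
        CompactOPF.IsParam s lamBar rho →
        (∃ (z : ℕ → CompactOPF.Pt n p) (lam : ℕ → EuclideanSpace ℝ (Fin m)),
          P.IsRun (Metric.closedBall zs r) s lamBar rho z lam) ∧
        ∀ (z : ℕ → CompactOPF.Pt n p) (lam : ℕ → EuclideanSpace ℝ (Fin m)),
          P.IsRun (Metric.closedBall zs r) s lamBar rho z lam →
          Tendsto z atTop (𝓝 zs) ∧
          (∀ᶠ k in atTop, IsLocalMaxOn (P.augLagrangian (rho k) (lam k))
            (P.searchSet univ) (z (k + 1))) ∧
          ∀ lamS : EuclideanSpace ℝ (Fin m), CompactOPF.InBox lamBar lamS → s = -1 →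
            Convex ℝ P.xSet → P.IsTheMultiplier zs lamS →
            Tendsto lam atTop (𝓝 lamS)) := by
  have hgU : ∀ y ∈ U, ContDiffAt ℝ 2 P.g y := fun y hy => hg.contDiffAt (hU.mem_nhds hy)
  constructor
  · intro N hN hNU hne s lamBar rho hpar z lam hrun
    have hgN : ∀ w ∈ N, ContDiffAt ℝ 2 P.g w.2 := fun w hw => hgU _ (hNU w hw)
    refine ⟨hrun.tendsto_residual hpar hne, fun zc hzc => ?_, fun ⟨ε, hε, hb⟩ =>
      hrun.convergence hpar hne hf hh hN hgN hε hb⟩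
    have hsol := hrun.mem_solutions hpar hne hf.continuous hh hN
      (fun w hw => (hgN w hw).continuousAt) hzc
    exact ⟨hsol, CompactOPF.isLocalOptimum_of_mem_solutions hsol⟩
  · intro zs hzs hzsU
    have hUz : ∀ᶠ w in 𝓝 zs, w.2 ∈ U := continuousAt_snd.eventually (hU.mem_nhds hzsU)
    obtain ⟨r₀, hr₀, hball⟩ := Metric.nhds_basis_closedBall.eventually_iff.1 (hzs.2.and hUz)
    refine ⟨r₀, hr₀, fun r hr hrr s lamBar rho hpar => ?_⟩
    have hsubset := Metric.closedBall_subset_closedBall (x := zs) hrr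
    have hgN : ∀ w ∈ Metric.closedBall zs r, ContDiffAt ℝ 2 P.g w.2 := fun w hw =>
      hgU _ (hball (hsubset hw)).2
    have hmem : zs ∈ P.feasible ∩ Metric.closedBall zs r :=
      ⟨hzs.1, Metric.mem_closedBall_self hr.le⟩
    refine ⟨CompactOPF.exists_isRun hf.continuous hh (isCompact_closedBall zs r)
      (fun w hw => (hgN w hw).continuousAt) ⟨zs, hmem.2, hmem.1.2⟩ s lamBar rho,
      fun z lam hrun => ?_⟩
    have hsol : P.solutions (Metric.closedBall zs r) = {zs} :=
      CompactOPF.solutions_eq_singleton hmem fun w hw => (hball (hsubset hw)).1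
    obtain ⟨-, -, -, hconv, hloc⟩ := hrun.convergence hpar ⟨zs, hmem⟩ hf hh
      Metric.isClosed_closedBall hgN one_pos
      (Metric.isBounded_closedBall.subset fun w hw => hw.1.1)
    have hint : P.solutions (Metric.closedBall zs r) ⊆ interior (Metric.closedBall zs r) := by
      rw [hsol, singleton_subset_iff]
      exact mem_interior_iff_mem_nhds.2 (Metric.closedBall_mem_nhds zs hr)
    refine ⟨hconv zs hsol, (hloc hint).1, fun lamS hbox hs hX hthe =>
      (hloc hint).2 lamS hbox hs hX ?_⟩
    rw [hsol]
    rintro _ rfl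
    exact hthe
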